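/- An aligned box in $\mathbb{R}^d$ is a set of the form $[a_1,b_1]\times\cdots\times[a_d,b_d]$ with $a_i<b_i$ for $i=1,\dots,d$. For every integer $d\ge 1$ there are a set $Y\subset\mathbb{R}^d$ and a constant $C>0$ such that for every aligned box $B$ of volume $1$, $$1\le \#(B\cap Y)\le C.$$ Moreover $Y$ can be taken to be a rescaled lattice of integers of a totally real number field: there are a totally real number field $K$ of degree $d$, with distinct embeddings $\sigma_1,\dots,\sigma_d:K\to\mathbb{R}$ and ring of integers $\mathcal{O}_K$, and a real number $s>0$, such that $$Y=\{\,s\,(\sigma_1(x),\dots,\sigma_d(x)) : x\in\mathcal{O}_K\,\}.$$ In particular, for every $d \ge 1$ the following assertion is false: if $Y\subseteq\mathbb{R}^d$ meets every aligned box of volume $s$ for some $s>0$, then for every $n\in\mathbb{N}$ and $\varepsilon>0$ there is an aligned box $B$ of volume less than $\varepsilon$ with $\#(B\cap Y)\ge n$. -/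

import Mathlib

open MeasureTheory NumberField

/-- `B` is an aligned box in `ℝ^d`: `B = [a₁, b₁] × ⋯ × [a_d, b_d]` for some `a_i < b_i`. -/
def IsAlignedBox {d : ℕ} (B : Set (Fin d → ℝ)) : Prop :=
  ∃ a b : Fin d → ℝ, (∀ i, a i < b i) ∧ B = Set.univ.pi fun i => Set.Icc (a i) (b i)

/-- The image of the ring of integers of `K` under the geometric embedding
`x ↦ (σ₁(x), …, σ_d(x))` into `ℝ^d`, where `σ` enumerates the real embeddings of `K`. -/
def geometricEmbedding {d : ℕ} (K : Type) [Field K] (σ : Fin d ≃ (K →+* ℝ)) :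
    Set (Fin d → ℝ) :=
  Set.range fun (x : 𝓞 K) (i : Fin d) => σ i (x : K)

/-- `Y` arises from a totally real number field `K` of degree `d`: up to scaling by a positive
factor it is the image of the ring of integers of `K` under the geometric embedding. -/
def IsTotallyRealLattice {d : ℕ} (Y : Set (Fin d → ℝ)) : Prop :=
  ∃ (K : Type) (_ : Field K) (_ : NumberField K) (σ : Fin d ≃ (K →+* ℝ)) (s : ℝ),
    IsTotallyReal K ∧ Module.finrank ℚ K = d ∧ 0 < s ∧
      Y = (fun y => s • y) '' geometricEmbedding K σ

/-- The Danzer property for aligned boxes: there is `s > 0` such that `Y` meets every aligned box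
of volume `s`. -/
def IsBoxDanzer {d : ℕ} (Y : Set (Fin d → ℝ)) : Prop :=
  ∃ s : ℝ, 0 < s ∧
    ∀ B : Set (Fin d → ℝ), IsAlignedBox B → volume B = ENNReal.ofReal s → (B ∩ Y).Nonempty

/-- `Y` has arbitrarily many points in aligned boxes of arbitrarily small volume. -/
def HasCrowdedBoxes {d : ℕ} (Y : Set (Fin d → ℝ)) : Prop :=
  ∀ (n : ℕ) (ε : ℝ), 0 < ε →
    ∃ B : Set (Fin d → ℝ), IsAlignedBox B ∧ volume B < ENNReal.ofReal ε ∧ (n : ℕ∞) ≤ (B ∩ Y).encard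

/-! Let Y be a scaled copy of the lattice of `𝓞 K`, with K totally real of degree d. The coordinate
differences of two distinct points multiply to a fixed scale times the absolute norm of a nonzero
integer, hence to at least some δ > 0. So a box of volume below δ holds at most one point, which
refutes crowding, and slicing a unit box into slabs bounds its count. For the lower bound, the
lattice has a finite covering radius R. Given half-sides h with large product, Minkowski yields x ≠
0 with |σ_i x| ≤ h_i / R. The sublattice x𝓞_K is the lattice stretched diagonally by the σ_i x, so
it comes within h_i of every point in each coordinate. -/

/-- A totally real number field of every positive degree, as a subfield of a cyclotomic field. -/
theorem exists_isTotallyReal_finrank_eq (d : ℕ) (hd : 1 ≤ d) :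
    ∃ (K : Type) (_ : Field K) (_ : NumberField K),
      IsTotallyReal K ∧ Module.finrank ℚ K = d := by
  -- The cyclic Galois group of order p - 1 then has a subgroup of index d and even order, which
  -- must contain complex conjugation.
  obtain ⟨p, hp, hp2, hmod⟩ := Nat.exists_prime_gt_modEq_one (k := 2 * d) 2 (by omega)
  have : Fact p.Prime := ⟨hp⟩
  obtain ⟨k, hk⟩ : 2 * d ∣ p - 1 := (Nat.modEq_iff_dvd' hp.one_le).mp hmod.symm
  let L := CyclotomicField p ℚ
  have : IsCyclotomicExtension {p} ℚ L := CyclotomicField.isCyclotomicExtension p ℚ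
  have : NumberField L := IsCyclotomicExtension.numberField {p} ℚ L
  have : IsGalois ℚ L := IsCyclotomicExtension.isGalois {p} ℚ L
  have hcm : IsCMField L :=
    IsCyclotomicExtension.Rat.isCMField L ⟨p, Set.mem_singleton p, hp2⟩
  have : IsCyclic (L ≃ₐ[ℚ] L) :=
    (IsCyclotomicExtension.autEquivPow L
      (Polynomial.cyclotomic.irreducible_rat hp.pos)).isCyclic.mpr inferInstance
  have hcard : Nat.card (L ≃ₐ[ℚ] L) = 2 * d * k := by
    rw [IsGalois.card_aut_eq_finrank, IsCyclotomicExtension.finrank L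
      (Polynomial.cyclotomic.irreducible_rat hp.pos), Nat.totient_prime hp, hk]
  have hk0 : 0 < k := by
    rcases Nat.eq_zero_or_pos k with h | h
    · subst h; omega
    · exact h
  obtain ⟨g, hg⟩ := IsCyclic.exists_generator (α := L ≃ₐ[ℚ] L)
  have hord : orderOf g = 2 * d * k := by rw [orderOf_eq_card_of_forall_mem_zpowers hg, hcard]
  let H := Subgroup.zpowers (g ^ d)
  have hH : Nat.card H = 2 * k := by
    rw [Nat.card_zpowers, orderOf_pow_of_dvd (by omega) (by rw [hord]; exact ⟨2 * k, by ring⟩), hord]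
    rw [show 2 * d * k = 2 * k * d by ring]
    exact Nat.mul_div_cancel _ hd
  let F := IntermediateField.fixedField H
  have hconj : (IsCMField.complexConj L).restrictScalars ℚ ∈ H := by
    obtain ⟨m, hm⟩ := Subgroup.mem_zpowers_iff.mp
      (hg ((IsCMField.complexConj L).restrictScalars ℚ))
    have hsq : g ^ (2 * m) = 1 := by
      rw [mul_comm, zpow_mul, hm]
      ext x
      simp
    -- 2m is a multiple of 2dk, so m is a multiple of d.
    obtain ⟨c, hc⟩ := orderOf_dvd_iff_zpow_eq_one.mpr hsq
    rw [← hm]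
    refine Subgroup.mem_zpowers_iff.mpr ⟨k * c, ?_⟩
    rw [← zpow_natCast, ← zpow_mul]
    congr 1
    rw [hord] at hc
    push_cast at hc
    linarith
  refine ⟨F, inferInstance, inferInstance, ?_, ?_⟩
  · have hle : F.toSubfield ≤ maximalRealSubfield L := by
      intro x hx φ
      have h := IsCMField.complexEmbedding_complexConj L φ x
      have hfix : IsCMField.complexConj L x = x := hx ⟨_, hconj⟩
      rw [hfix] at h
      exact h.symm
    exact isTotallyReal_iff_le_maximalRealSubfield.mpr hle
  · have h1 := IntermediateField.finrank_fixedField_eq_card H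
    have h2 := Module.finrank_mul_finrank ℚ F L
    rw [h1, hH, ← IsGalois.card_aut_eq_finrank ℚ L, hcard] at h2
    have : Module.finrank ℚ F * (2 * k) = d * (2 * k) := by rw [h2]; ring
    exact Nat.eq_of_mul_eq_mul_right (by omega) this

/-! ### Real embeddings and the lattice of integers -/

namespace NumberField

variable (K : Type*) [Field K]

/-- The real embeddings of a totally real field correspond to its infinite places. -/
noncomputable def realEmbeddingEquivInfinitePlace [IsTotallyReal K] :
    (K →+* ℝ) ≃ InfinitePlace K where
  toFun φ := InfinitePlace.mk (Complex.ofRealHom.comp φ)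
  invFun w := InfinitePlace.embedding_of_isReal (IsTotallyReal.isReal w)
  left_inv φ := by
    have hφ : ComplexEmbedding.IsReal (Complex.ofRealHom.comp φ) :=
      IsTotallyReal.complexEmbedding_isReal _
    ext x
    apply Complex.ofReal_injective
    rw [InfinitePlace.embedding_of_isReal_apply, InfinitePlace.embedding_mk_eq_of_isReal hφ]
    rfl
  right_inv w := by
    have h : Complex.ofRealHom.comp
        (InfinitePlace.embedding_of_isReal (IsTotallyReal.isReal w)) = w.embedding := by
      ext x
      exact InfinitePlace.embedding_of_isReal_apply _ x
    exact (congrArg InfinitePlace.mk h).trans (InfinitePlace.mk_embedding w)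

variable {K}

theorem realEmbeddingEquivInfinitePlace_apply [IsTotallyReal K] (φ : K →+* ℝ) (x : K) :
    realEmbeddingEquivInfinitePlace K φ x = |φ x| := by
  change ‖((φ x : ℝ) : ℂ)‖ = _
  rw [Complex.norm_real, Real.norm_eq_abs]

theorem embedding_of_isReal_realEmbeddingEquivInfinitePlace [IsTotallyReal K] (φ : K →+* ℝ)
    (h : (realEmbeddingEquivInfinitePlace K φ).IsReal) :
    InfinitePlace.embedding_of_isReal h = φ :=
  (realEmbeddingEquivInfinitePlace K).symm_apply_apply φ

variable [NumberField K]

theorem nonempty_equiv_realEmbedding [IsTotallyReal K] {d : ℕ}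
    (hd : Module.finrank ℚ K = d) : Nonempty (Fin d ≃ (K →+* ℝ)) := by
  classical
  have h : Fintype.card (InfinitePlace K) = d := by
    rw [InfinitePlace.card_eq_nrRealPlaces_add_nrComplexPlaces,
      IsTotallyReal.nrComplexPlaces_eq_zero, add_zero, ← IsTotallyReal.finrank, hd]
  exact ⟨(Fintype.equivFinOfCardEq h).symm.trans (realEmbeddingEquivInfinitePlace K).symm⟩

section Lattice

variable [IsTotallyReal K] {d : ℕ} (σ : Fin d ≃ (K →+* ℝ))

theorem prod_infinitePlace_eq_prod_realEmbedding {M : Type*} [CommMonoid M]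
    (f : InfinitePlace K → M) :
    ∏ w, f w = ∏ i, f (realEmbeddingEquivInfinitePlace K (σ i)) :=
  (Fintype.prod_equiv (σ.trans (realEmbeddingEquivInfinitePlace K)) _ _ fun _ => rfl).symm

/-- The product is the absolute value of the norm, a nonzero integer. -/
theorem one_le_prod_abs_realEmbedding {x : 𝓞 K} (hx : x ≠ 0) :
    1 ≤ ∏ i, |σ i (x : K)| := by
  have h := InfinitePlace.prod_eq_abs_norm (x : K)
  rw [prod_infinitePlace_eq_prod_realEmbedding σ] at h
  simp only [IsTotallyReal.mult_eq, pow_one, realEmbeddingEquivInfinitePlace_apply] at h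
  rw [h, ← Algebra.coe_norm_int]
  have : Algebra.norm ℤ x ≠ 0 := Algebra.norm_ne_zero_iff.mpr hx
  have h1 := Int.one_le_abs this
  exact_mod_cast h1

/-- The geometric lattice of the ring of integers has finite covering radius. -/
theorem exists_realEmbedding_covering_radius :
    ∃ R : ℝ, 0 < R ∧ ∀ v : Fin d → ℝ, ∃ x : 𝓞 K, ∀ i, |v i - σ i (x : K)| ≤ R := by
  classical
  let b := mixedEmbedding.latticeBasis K
  refine ⟨∑ i, ‖b i‖ + 1, by positivity, fun v => ?_⟩
  let e := σ.trans (realEmbeddingEquivInfinitePlace K)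
  -- The complex component is vacuous: K has no complex places.
  let m : mixedEmbedding.mixedSpace K := (fun w => v (e.symm w.1), 0)
  have hmem : (ZSpan.floor b m : mixedEmbedding.mixedSpace K) ∈
      Submodule.span ℤ (Set.range b) := (ZSpan.floor b m).2
  rw [mixedEmbedding.mem_span_latticeBasis] at hmem
  obtain ⟨x, hx⟩ : ∃ x : 𝓞 K, mixedEmbedding K (x : K) = ZSpan.floor b m := by
    obtain ⟨x, hx⟩ := hmem
    exact ⟨x, hx⟩
  refine ⟨x, fun i => ?_⟩
  have hn : ‖ZSpan.fract b m‖ ≤ ∑ i, ‖b i‖ := ZSpan.norm_fract_le b m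
  have hw := IsTotallyReal.isReal (e i)
  have h1 : ‖(ZSpan.fract b m).1 ⟨e i, hw⟩‖ ≤ ‖ZSpan.fract b m‖ :=
    (norm_le_pi_norm _ _).trans (norm_fst_le _)
  have h2 : (ZSpan.fract b m).1 ⟨e i, hw⟩ = v i - σ i (x : K) := by
    rw [ZSpan.fract_apply, ← hx, Prod.fst_sub, Pi.sub_apply]
    congr 1
    · simp [m]
    · refine (mixedEmbedding.mixedEmbedding_apply_isReal K x ⟨e i, hw⟩).trans ?_
      rw [show InfinitePlace.embedding_of_isReal hw = σ i from
        embedding_of_isReal_realEmbeddingEquivInfinitePlace (σ i) hw]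
  rw [h2, Real.norm_eq_abs] at h1
  linarith

/-- Minkowski's theorem for boxes: large centred boxes contain a nonzero algebraic integer. -/
theorem exists_ne_zero_abs_realEmbedding_le :
    ∃ c : ℝ, 0 < c ∧ ∀ a : Fin d → ℝ, (∀ i, 0 < a i) → c ≤ ∏ i, a i →
      ∃ x : 𝓞 K, x ≠ 0 ∧ ∀ i, |σ i (x : K)| ≤ a i := by
  classical
  have htop := mixedEmbedding.minkowskiBound_lt_top K 1
  -- The 1 makes Minkowski's volume inequality strict.
  refine ⟨(mixedEmbedding.minkowskiBound K 1).toReal + 1, by positivity, fun a ha hc => ?_⟩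
  let e := σ.trans (realEmbeddingEquivInfinitePlace K)
  let f : InfinitePlace K → NNReal := fun w => (a (e.symm w)).toNNReal
  have hvol : mixedEmbedding.minkowskiBound K 1 <
      volume (mixedEmbedding.convexBodyLT K f) := by
    rw [mixedEmbedding.convexBodyLT_volume]
    have hprod : ((∏ w, f w ^ w.mult : NNReal) : ℝ) = ∏ i, a i := by
      rw [prod_infinitePlace_eq_prod_realEmbedding σ, NNReal.coe_prod]
      refine Finset.prod_congr rfl fun i _ => ?_
      have : e.symm (realEmbeddingEquivInfinitePlace K (σ i)) = i := e.symm_apply_apply i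
      simp [f, this, (ha i).le]
    have h1 : mixedEmbedding.minkowskiBound K 1 < ((∏ w, f w ^ w.mult : NNReal) : ENNReal) := by
      rw [← ENNReal.ofReal_toReal htop.ne, ← ENNReal.ofReal_coe_nnreal, hprod]
      exact (ENNReal.ofReal_lt_ofReal_iff (Finset.prod_pos fun i _ => ha i)).mpr (by linarith)
    refine h1.trans_le (le_mul_of_one_le_left' ?_)
    exact_mod_cast mixedEmbedding.one_le_convexBodyLTFactor K
  obtain ⟨x, hx0, hx⟩ := mixedEmbedding.exists_ne_zero_mem_ringOfIntegers_lt K hvol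
  refine ⟨x, hx0, fun i => ?_⟩
  have h := (hx (e i)).le
  have h2 : (f (e i) : ℝ) = a i := by simp [f, (ha i).le]
  rw [h2] at h
  rwa [← realEmbeddingEquivInfinitePlace_apply]

/-- Every box of sufficiently large volume, given by its centre `v` and half-sides `h`, contains
the geometric image of an algebraic integer. -/
theorem exists_abs_sub_realEmbedding_le :
    ∃ V : ℝ, 0 < V ∧ ∀ v h : Fin d → ℝ, (∀ i, 0 < h i) → V ≤ ∏ i, h i →
      ∃ x : 𝓞 K, ∀ i, |v i - σ i (x : K)| ≤ h i := by
  obtain ⟨R, hR, hcov⟩ := exists_realEmbedding_covering_radius σ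
  obtain ⟨c, hc, hmin⟩ := exists_ne_zero_abs_realEmbedding_le σ
  refine ⟨c * R ^ d, by positivity, fun v h hh hV => ?_⟩
  obtain ⟨x, hx0, hx⟩ := hmin (fun i => h i / R) (fun i => div_pos (hh i) hR) (by
    rw [Finset.prod_div_distrib, Finset.prod_const, Finset.card_univ, Fintype.card_fin]
    exact (le_div_iff₀ (by positivity)).mpr hV)
  obtain ⟨y, hy⟩ := hcov fun i => v i / σ i (x : K)
  refine ⟨x * y, fun i => ?_⟩
  have hne : σ i (x : K) ≠ 0 := by
    rw [map_ne_zero]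
    exact RingOfIntegers.coe_ne_zero_iff.mpr hx0
  have hfac : v i - σ i ((x * y : 𝓞 K) : K) =
      σ i (x : K) * (v i / σ i (x : K) - σ i (y : K)) := by
    rw [show ((x * y : 𝓞 K) : K) = x * y from map_mul _ x y, map_mul, mul_sub, mul_div_cancel₀ _ hne]
  rw [hfac, abs_mul]
  calc _ ≤ h i / R * R := mul_le_mul (hx i) (hy i) (abs_nonneg _) (div_pos (hh i) hR).le
    _ = h i := div_mul_cancel₀ _ hR.ne'

end Lattice

end NumberField

/-! ### Counting points in boxes -/

theorem abs_sub_lt_one_of_natFloor_eq {x y : ℝ} (hx : 0 ≤ x) (hy : 0 ≤ y)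
    (h : ⌊x⌋₊ = ⌊y⌋₊) : |x - y| < 1 := by
  have hx1 := Nat.floor_le hx
  have hy1 := Nat.floor_le hy
  have hx2 := Nat.lt_floor_add_one x
  have hy2 := Nat.lt_floor_add_one y
  rw [h] at hx1 hx2
  exact abs_sub_lt_iff.mpr ⟨by linarith, by linarith⟩

/-- Distinct points of a rescaled geometric lattice have coordinate differences with product
bounded below. -/
theorem pow_le_prod_abs_sub_of_ne {K : Type} [Field K] [NumberField K] [IsTotallyReal K] {d : ℕ}
    (σ : Fin d ≃ (K →+* ℝ)) {s : ℝ} (hs : 0 < s) {y z : Fin d → ℝ}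
    (hy : y ∈ (fun y => s • y) '' geometricEmbedding K σ)
    (hz : z ∈ (fun y => s • y) '' geometricEmbedding K σ) (hne : y ≠ z) :
    s ^ d ≤ ∏ i, |y i - z i| := by
  obtain ⟨_, ⟨u, rfl⟩, rfl⟩ := hy
  obtain ⟨_, ⟨v, rfl⟩, rfl⟩ := hz
  have huv : u - v ≠ 0 := fun h => hne (by rw [sub_eq_zero.mp h])
  have h := one_le_prod_abs_realEmbedding σ huv
  have heq : ∀ i, |(s • fun i => σ i (u : K)) i - (s • fun i => σ i (v : K)) i| =
      s * |σ i ((u - v : 𝓞 K) : K)| := fun i => by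
    rw [Pi.smul_apply, Pi.smul_apply, ← smul_sub, smul_eq_mul, abs_mul, abs_of_pos hs]
    simp
  rw [Finset.prod_congr rfl fun i _ => heq i, Finset.prod_mul_distrib, Finset.prod_const,
    Finset.card_univ, Fintype.card_fin]
  exact le_mul_of_one_le_right (by positivity) h

/-- The volume of an aligned box. -/
theorem volume_pi_Icc_eq {d : ℕ} {a b : Fin d → ℝ} (hab : ∀ i, a i < b i) :
    volume (Set.univ.pi fun i => Set.Icc (a i) (b i)) = ENNReal.ofReal (∏ i, (b i - a i)) := by
  rw [volume_pi_pi, ENNReal.ofReal_prod_of_nonneg fun i _ => (sub_pos.mpr (hab i)).le]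
  simp

/-- A box of volume less than the separation constant contains at most one point. -/
theorem encard_box_inter_le_one {d : ℕ} {Y : Set (Fin d → ℝ)} {δ : ℝ}
    (hY : ∀ y ∈ Y, ∀ z ∈ Y, y ≠ z → δ ≤ ∏ i, |y i - z i|) {a b : Fin d → ℝ}
    (h : ∏ i, (b i - a i) < δ) :
    ((Set.univ.pi fun i => Set.Icc (a i) (b i)) ∩ Y).encard ≤ 1 := by
  refine Set.encard_le_one_iff.mpr fun y z hy hz => ?_
  by_contra hne
  refine absurd (hY y hy.2 z hz.2 hne) (not_le.mpr (lt_of_le_of_lt ?_ h))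
  exact Finset.prod_le_prod (fun i _ => abs_nonneg _) fun i _ =>
    abs_sub_le_of_le_of_le (hy.1 i trivial).1 (hy.1 i trivial).2
      (hz.1 i trivial).1 (hz.1 i trivial).2

/-- A box of volume less than `N` times the separation constant contains at most `N + 1` points. -/
theorem encard_box_inter_le {d : ℕ} (hd : 1 ≤ d) {Y : Set (Fin d → ℝ)} {δ : ℝ}
    (hY : ∀ y ∈ Y, ∀ z ∈ Y, y ≠ z → δ ≤ ∏ i, |y i - z i|) {a b : Fin d → ℝ}
    (hab : ∀ i, a i < b i) {N : ℕ} (hN : 0 < N) (h : ∏ i, (b i - a i) < N * δ) :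
    ((Set.univ.pi fun i => Set.Icc (a i) (b i)) ∩ Y).encard ≤ (N + 1 : ℕ) := by
  classical
  let j : Fin d := ⟨0, hd⟩
  have hN' : (0 : ℝ) < N := Nat.cast_pos.mpr hN
  have hj : 0 < b j - a j := sub_pos.mpr (hab j)
  -- Index of the slab containing y when side j is cut into N equal pieces; the right endpoint gets
  -- the extra index N. Two points in one slab would violate the separation by δ.
  let g : (Fin d → ℝ) → ℕ := fun y => ⌊(y j - a j) * N / (b j - a j)⌋₊
  have hmaps : Set.MapsTo g ((Set.univ.pi fun i => Set.Icc (a i) (b i)) ∩ Y)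
      (Finset.range (N + 1) : Set ℕ) := fun y hy => by
    rw [Finset.mem_coe, Finset.mem_range, Nat.lt_succ_iff]
    refine Nat.floor_le_of_le ?_
    rw [div_le_iff₀ hj, mul_comm]
    exact mul_le_mul_of_nonneg_left (sub_le_sub_right (hy.1 j trivial).2 _) hN'.le
  have hinj : Set.InjOn g ((Set.univ.pi fun i => Set.Icc (a i) (b i)) ∩ Y) := by
    intro y hy z hz hg
    by_contra hne
    have h1 : |(y j - a j) * N / (b j - a j) - (z j - a j) * N / (b j - a j)| < 1 :=
      abs_sub_lt_one_of_natFloor_eq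
        (div_nonneg (mul_nonneg (sub_nonneg.mpr (hy.1 j trivial).1) hN'.le) hj.le)
        (div_nonneg (mul_nonneg (sub_nonneg.mpr (hz.1 j trivial).1) hN'.le) hj.le) hg
    have h2 : |y j - z j| * N ≤ b j - a j := by
      rw [show (y j - a j) * N / (b j - a j) - (z j - a j) * N / (b j - a j) =
        (y j - z j) * N / (b j - a j) by ring, abs_div, abs_mul, abs_of_pos hj,
        abs_of_pos hN', div_lt_one hj] at h1
      exact h1.le
    have h3 : (∏ i, |y i - z i|) * N ≤ ∏ i, (b i - a i) := by
      rw [← Finset.mul_prod_erase _ _ (Finset.mem_univ j),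
        ← Finset.mul_prod_erase _ (fun i => b i - a i) (Finset.mem_univ j), mul_right_comm]
      refine mul_le_mul h2 ?_ (Finset.prod_nonneg fun i _ => abs_nonneg _) hj.le
      exact Finset.prod_le_prod (fun i _ => abs_nonneg _) fun i _ =>
        abs_sub_le_of_le_of_le (hy.1 i trivial).1 (hy.1 i trivial).2
          (hz.1 i trivial).1 (hz.1 i trivial).2
    have h4 := mul_le_mul_of_nonneg_right (hY y hy.2 z hz.2 hne) hN'.le
    linarith
  refine (Set.encard_le_encard_of_injOn hmaps hinj).trans ?_
  rw [Set.encard_coe_eq_coe_finsetCard, Finset.card_range]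

/-- In every dimension there is a rescaled geometric lattice of a totally real field which meets
every aligned box of volume one, and which is separated in the sense of products. -/
theorem exists_isTotallyRealLattice_meets_boxes (d : ℕ) (hd : 1 ≤ d) :
    ∃ (Y : Set (Fin d → ℝ)) (δ : ℝ), IsTotallyRealLattice Y ∧ 0 < δ ∧
      (∀ y ∈ Y, ∀ z ∈ Y, y ≠ z → δ ≤ ∏ i, |y i - z i|) ∧
      ∀ B : Set (Fin d → ℝ), IsAlignedBox B → volume B = 1 → (B ∩ Y).Nonempty := by
  obtain ⟨K, hF, hNF, hreal, hdeg⟩ := exists_isTotallyReal_finrank_eq d hd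
  obtain ⟨σ⟩ := nonempty_equiv_realEmbedding hdeg
  obtain ⟨V, hV, hmeet⟩ := exists_abs_sub_realEmbedding_le σ
  -- 2^d passes from sides to half-sides; the 1 ensures t ≤ t^d, avoiding a d-th root.
  let t : ℝ := 2 ^ d * V + 1
  have ht : 1 ≤ t := le_add_of_nonneg_left (by positivity)
  have ht0 : 0 < t := by positivity
  have hs : 0 < t⁻¹ := inv_pos.mpr ht0
  refine ⟨(fun y => t⁻¹ • y) '' geometricEmbedding K σ, t⁻¹ ^ d,
    ⟨K, hF, hNF, σ, t⁻¹, hreal, hdeg, hs, rfl⟩, pow_pos hs d,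
    fun y hy z hz hne => pow_le_prod_abs_sub_of_ne σ hs hy hz hne, ?_⟩
  rintro B ⟨a, b, hab, rfl⟩ hvol
  rw [volume_pi_Icc_eq hab, ENNReal.ofReal_eq_one] at hvol
  obtain ⟨x, hx⟩ := hmeet (fun i => t * ((a i + b i) / 2)) (fun i => t / 2 * (b i - a i))
    (fun i => mul_pos (by positivity) (sub_pos.mpr (hab i))) (by
      rw [Finset.prod_mul_distrib, hvol, Finset.prod_const, Finset.card_univ, Fintype.card_fin,
        mul_one, div_pow, le_div_iff₀ (by positivity)]
      calc V * 2 ^ d ≤ t := by simp only [t]; linarith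
        _ ≤ t ^ d := le_self_pow₀ ht (by omega))
  refine ⟨t⁻¹ • fun i => σ i (x : K), fun i _ => ?_, _, ⟨x, rfl⟩, rfl⟩
  obtain ⟨h1, h2⟩ := abs_le.mp (hx i)
  rw [Pi.smul_apply, smul_eq_mul, Set.mem_Icc, inv_mul_eq_div, le_div_iff₀ ht0,
    div_le_iff₀ ht0]
  constructor <;> nlinarith

theorem proposition5p3 (d : ℕ) (hd : 1 ≤ d) :
    (∃ (Y : Set (Fin d → ℝ)) (C : ℕ), 0 < C ∧ IsTotallyRealLattice Y ∧
      ∀ B : Set (Fin d → ℝ), IsAlignedBox B → volume B = 1 →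
        1 ≤ (B ∩ Y).encard ∧ (B ∩ Y).encard ≤ (C : ℕ∞)) ∧
    ¬ ∀ Y : Set (Fin d → ℝ), IsBoxDanzer Y → HasCrowdedBoxes Y := by
  obtain ⟨Y, δ, hlat, hδ, hsep, hmeet⟩ := exists_isTotallyRealLattice_meets_boxes d hd
  constructor
  · obtain ⟨N, hN⟩ := exists_nat_gt (1 / δ)
    have hN0 : 0 < N := Nat.cast_pos.mp ((one_div_pos.mpr hδ).trans hN)
    refine ⟨Y, N + 1, Nat.succ_pos N, hlat, fun B hB hvol => ⟨?_, ?_⟩⟩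
    · exact Set.one_le_encard_iff_nonempty.mpr (hmeet B hB hvol)
    · obtain ⟨a, b, hab, rfl⟩ := hB
      rw [volume_pi_Icc_eq hab, ENNReal.ofReal_eq_one] at hvol
      exact encard_box_inter_le hd hsep hab hN0 (by rw [hvol]; exact (div_lt_iff₀ hδ).mp hN)
  · intro hall
    obtain ⟨B, ⟨a, b, hab, rfl⟩, hvol, hcard⟩ :=
      hall Y ⟨1, one_pos, fun B hB hvol => hmeet B hB (by rw [hvol, ENNReal.ofReal_one])⟩ 2 δ hδ
    rw [volume_pi_Icc_eq hab, ENNReal.ofReal_lt_ofReal_iff hδ] at hvol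
    have h := hcard.trans (encard_box_inter_le_one hsep hvol)
    norm_num at h
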